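/- Let $n\ge 1$, let $M$ be a smooth manifold and let $\omega\in\Omega^{n+1}(M)$ be closed. A vector field $v_\alpha$ is a Hamiltonian vector field of $\alpha\in\Omega^{n-1}(M)$ if $d\alpha=-\iota_{v_\alpha}\omega$; $\alpha$ is Hamiltonian if such a $v_\alpha$ exists. Let $\mathfrak g$ be a real Lie algebra, let $\partial\colon\Lambda^k\mathfrak g\to\Lambda^{k-1}\mathfrak g$, $$\partial(x_1\wedge\dots\wedge x_k)=\sum_{1\le i<j\le k}(-1)^{i+j}[x_i,x_j]\wedge x_1\wedge\dots\wedge\hat x_i\wedge\dots\wedge\hat x_j\wedge\dots\wedge x_k ,$$ be the Lie algebra homology differential, and let $Z_k(\mathfrak g)=\ker(\partial|_{\Lambda^k\mathfrak g})$. Let $v\colon\mathfrak g\to\mathfrak X(M)$, $x\mapsto v_x$, be a homomorphism of Lie algebras with $\mathcal L_{v_x}\omega=0$ for all $x\in\mathfrak g$. A (homotopy) co-momentum map for $v$ is a family of linear maps $f_k\colon\Lambda^k\mathfrak g\to\Omega^{n-k}(M)$, $1\le k\le n$, such that $f_1$ takes values in Hamiltonian forms, $d(f_1(x))=-\iota_{v_x}\omega$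 for all $x\in\mathfrak g$, and, with $f_0=0$, $f_{n+1}=0$ and $\varsigma(k)=-(-1)^{k(k+1)/2}$, $$-f_{k-1}(\partial p)=d f_k(p)+\varsigma(k)\,\iota_{v_{x_k}}\cdots\iota_{v_{x_1}}\omega\qquad\text{for } p=x_1\wedge\dots\wedge x_k,\quad 1\le k\le n+1 .$$ (1) Let $H\in\Omega^{n-1}(M)$ be Hamiltonian, let the action $v$ be locally $H$-preserving, i.e. $\mathcal L_{v_x}H$ is closed for all $x\in\mathfrak g$, and let $(f_k)$ be a co-momentum map for $v$. Then for every $1\le k\le n$, every $p\in Z_k(\mathfrak g)$ and every Hamiltonian vector field $v_H$ of $H$, the form $f_k(p)$ is locally conserved by $v_H$, i.e. $\mathcal L_{v_H}f_k(p)$ is closed. (2) In (1), $f_k(p)$ need not be globally conserved, i.e. $\mathcal L_{v_H}f_k(p)$ need not be exact, even if all $\mathcal L_{v_x}H$ are exact: let $M=\mathbb R^3$, $n=2$, $\omega=dx\wedge dy\wedge dz$, $H=-x\,dy$, $v_H=\frac{\partial}{\partial z}$, and let the two-dimensional abelian Lie algebra $\mathfrak g=\langle a,b\rangle_{\mathbb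 R}$ act by $v_a=\frac{\partial}{\partial x}$, $v_b=\frac{\partial}{\partial y}$. Then $v_H$ is a Hamiltonian vector field of $H$, the action preserves $\omega$, all $\mathcal L_{v_x}H$ are exact (in particular closed), and $f_1(a)=-y\,dz$, $f_1(b)=x\,dz$, $f_2(a\wedge b)=-z$ define a co-momentum map. Moreover $a\wedge b\in Z_2(\mathfrak g)$, but $\mathcal L_{v_H}f_2(a\wedge b)=-1$ is not exact (an exact $0$-form is $0$). -/

import Mathlib

open scoped Manifold

noncomputable section

/-! ## Differential forms and vector fields on a manifold

`M` is a smooth manifold without boundary modelled on the finite-dimensional real normed space `E`.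
A *form field* of degree `k` assigns to each point an alternating `k`-form on the tangent space,
without any regularity; the smooth ones form the real vector space `SmoothForm E M k`. -/

/-- Smooth vector fields on `M`. -/
abbrev SmoothVectorField (E : Type*) [NormedAddCommGroup E] [NormedSpace ℝ E]
    (M : Type*) [TopologicalSpace M] [ChartedSpace E M]
    [IsManifold 𝓘(ℝ, E) ((⊤ : ℕ∞) : WithTop ℕ∞) M] :=
  ContMDiffSection 𝓘(ℝ, E) E ((⊤ : ℕ∞) : WithTop ℕ∞) (TangentSpace 𝓘(ℝ, E) : M → Type _)

/-- Fields of alternating `k`-forms on `M`, with no regularity required. -/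
abbrev FormField (E : Type*) [NormedAddCommGroup E] [NormedSpace ℝ E]
    (M : Type*) [TopologicalSpace M] [ChartedSpace E M] (k : ℕ) :=
  ∀ x : M, TangentSpace 𝓘(ℝ, E) x [⋀^Fin k]→L[ℝ] ℝ

namespace FormField

variable {E : Type*} [NormedAddCommGroup E] [NormedSpace ℝ E]
  {M : Type*} [TopologicalSpace M] [ChartedSpace E M] {k l : ℕ}

/-- The coordinate expression of a form field in the preferred chart at `x₀`: its pullback under
the inverse of the chart, a form on (the chart's target in) `E`. -/
def inChart (x₀ : M) (α : FormField E M k) (y : E) : E [⋀^Fin k]→L[ℝ] ℝ :=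
  ContinuousAlternatingMap.compContinuousLinearMap (M := E)
    (α ((extChartAt 𝓘(ℝ, E) x₀).symm y))
    (mfderiv 𝓘(ℝ, E) 𝓘(ℝ, E) (extChartAt 𝓘(ℝ, E) x₀).symm y)

/-- Transport of an alternating form on `E` to the tangent space at `x₀` by the derivative of the
preferred chart at `x₀`. -/
def ofChart (x₀ : M) (β : E [⋀^Fin k]→L[ℝ] ℝ) : TangentSpace 𝓘(ℝ, E) x₀ [⋀^Fin k]→L[ℝ] ℝ :=
  ContinuousAlternatingMap.compContinuousLinearMap (M' := E) β
    (mfderiv 𝓘(ℝ, E) 𝓘(ℝ, E) (extChartAt 𝓘(ℝ, E) x₀) x₀)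

/-- A form field is smooth if all its coordinate expressions are smooth. -/
def IsSmooth (α : FormField E M k) : Prop :=
  ∀ x₀ : M, ContDiffOn ℝ ((⊤ : ℕ∞) : WithTop ℕ∞) (inChart x₀ α) (extChartAt 𝓘(ℝ, E) x₀).target

/-- Exterior derivative, computed in charts. -/
def d (α : FormField E M k) : FormField E M (k + 1) := fun x₀ =>
  ofChart x₀ (extDeriv (inChart x₀ α) (extChartAt 𝓘(ℝ, E) x₀ x₀))

/-- Contraction `ι_V α = α(V, ·, …, ·)`. -/
def contract (V : ∀ x : M, TangentSpace 𝓘(ℝ, E) x) (α : FormField E M (k + 1)) :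
    FormField E M k := fun x =>
  ContinuousAlternatingMap.curryLeft (E := E) (α x) (V x)

/-- Lie derivative on the model space:
`(L_V α)(w₁,…,w_k) = (D_V α)(w₁,…,w_k) + ∑ᵢ α(w₁,…,DV(wᵢ),…,w_k)`, i.e. the derivative at `t = 0`
of the pullback of `α` under the flow of `V`. -/
def lieDerivModel (V : E → E) (α : E → E [⋀^Fin k]→L[ℝ] ℝ) (y : E) : E [⋀^Fin k]→L[ℝ] ℝ :=
  fderiv ℝ α y (V y) +
    (α y).fderivCompContinuousLinearMap (ContinuousLinearMap.id ℝ E) (fderiv ℝ V y)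

/-- Lie derivative `L_V α`, computed in charts. -/
def lieDeriv (V : ∀ x : M, TangentSpace 𝓘(ℝ, E) x) (α : FormField E M k) : FormField E M k :=
  fun x₀ => ofChart x₀
    (lieDerivModel
      (fun y => VectorField.mpullback 𝓘(ℝ, E) 𝓘(ℝ, E) (extChartAt 𝓘(ℝ, E) x₀).symm V y)
      (inChart x₀ α) (extChartAt 𝓘(ℝ, E) x₀ x₀))

/-- Identification of form fields of equal degrees. -/
def castDeg (h : k = l) (α : FormField E M k) : FormField E M l := h ▸ α

/-- `ι(V₁ ∧ ⋯ ∧ V_k) = ι_{V_k} ⋯ ι_{V₁}`. -/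
def contractMulti {j : ℕ} : (k : ℕ) → (Fin k → ∀ x : M, TangentSpace 𝓘(ℝ, E) x) →
    FormField E M (j + k) → FormField E M j
  | 0, _, α => α
  | k + 1, V, α => contractMulti k (fun i => V i.succ) (contract (k := j + k) (V 0) α)

end FormField

/-- The real vector space `Ω^k(M)` of smooth differential `k`-forms. -/
def SmoothForm (E : Type*) [NormedAddCommGroup E] [NormedSpace ℝ E]
    (M : Type*) [TopologicalSpace M] [ChartedSpace E M] (k : ℕ) :
    Submodule ℝ (FormField E M k) where
  carrier := {α | α.IsSmooth}
  add_mem' := fun {_ _} ha hb x₀ => (ha x₀).add (hb x₀)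
  zero_mem' := fun _ => contDiffOn_const (c := (0 : E [⋀^Fin k]→L[ℝ] ℝ))
  smul_mem' := fun c _ ha x₀ => (ha x₀).const_smul c

section Notions

variable {E : Type*} [NormedAddCommGroup E] [NormedSpace ℝ E]
  {M : Type*} [TopologicalSpace M] [ChartedSpace E M] {k : ℕ}

/-- Closed differential forms. -/
def IsClosedForm (α : FormField E M k) : Prop := α.IsSmooth ∧ α.d = 0

/-- Exact differential forms; there are no nonzero forms of degree `-1`, so that an exact
`0`-form is zero. -/
def IsExactForm : {k : ℕ} → FormField E M k → Prop
  | 0, α => α = 0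
  | k + 1, α => ∃ β : SmoothForm E M k, (β : FormField E M k).d = α

/-- `α` is locally conserved by the vector field `V`: `L_V α` is closed. -/
def IsLocallyConserved (V : ∀ x : M, TangentSpace 𝓘(ℝ, E) x) (α : FormField E M k) : Prop :=
  IsClosedForm (α.lieDeriv V)

/-- `α` is globally conserved by the vector field `V`: `L_V α` is exact. -/
def IsGloballyConserved (V : ∀ x : M, TangentSpace 𝓘(ℝ, E) x) (α : FormField E M k) : Prop :=
  IsExactForm (α.lieDeriv V)

/-- `V` is a Hamiltonian vector field of the `m`-form `α` with respect to the `(m+2)`-form `ω`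
(so `n = m + 1`): `dα = -ι_V ω`. -/
def IsHamiltonianVectorField {m : ℕ} (ω : FormField E M (m + 2)) (α : FormField E M m)
    (V : ∀ x : M, TangentSpace 𝓘(ℝ, E) x) : Prop :=
  α.d = -ω.contract V

end Notions

/-! ## Lie algebra homology -/

section LieHomology

variable (𝔤 : Type*) [LieRing 𝔤] [LieAlgebra ℝ 𝔤]

/-- The right-hand side of the formula for the homology differential on `x₁ ∧ ⋯ ∧ x_{k+2}`:
`∑_{a<b} (-1)^{a+b} [x_a, x_b] ∧ x₁ ∧ ⋯ x̂_a ⋯ x̂_b ⋯ ∧ x_{k+2}`. The pairs `a < b` are written as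
`a = i.castSucc`, `b = j.succ` with `i ≤ j`. -/
def lieBoundaryFun (k : ℕ) (x : Fin (k + 2) → 𝔤) : ⋀[ℝ]^(k + 1) 𝔤 :=
  ∑ i : Fin (k + 1), ∑ j ≥ i, (-1 : ℝ) ^ ((i.castSucc : ℕ) + (j.succ : ℕ)) •
    exteriorPower.ιMulti ℝ (k + 1)
      (Matrix.vecCons ⁅x i.castSucc, x j.succ⁆ (j.removeNth (i.castSucc.removeNth x)))

/-- The trilinear expression `[x, y] ∧ z₁ ∧ ⋯ ∧ z_k`. -/
def lieBoundaryAux (k : ℕ) : 𝔤 →ₗ[ℝ] 𝔤 →ₗ[ℝ] 𝔤 [⋀^Fin k]→ₗ[ℝ] ⋀[ℝ]^(k + 1) 𝔤 :=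
  (LieModule.toEnd ℝ 𝔤 𝔤 : 𝔤 →ₗ[ℝ] 𝔤 →ₗ[ℝ] 𝔤).compr₂
    (AlternatingMap.curryLeft (exteriorPower.ιMulti ℝ (k + 1)))

theorem lieBoundaryFun_eq (k : ℕ) (x : Fin (k + 2) → 𝔤) :
    lieBoundaryFun 𝔤 k x = (-(1 / 2) : ℝ) • AlternatingMap.alternatizeUncurryFin
      (AlternatingMap.alternatizeUncurryFinLM ∘ₗ lieBoundaryAux 𝔤 k) x := by
  rw [AlternatingMap.alternatizeUncurryFin_alternatizeUncurryFinLM_comp_apply, Finset.smul_sum]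
  refine Finset.sum_congr rfl fun i _ => ?_
  rw [Finset.smul_sum]
  refine Finset.sum_congr rfl fun j _ => ?_
  have h (a b : 𝔤) (z : Fin k → 𝔤) : lieBoundaryAux 𝔤 k a b z =
      exteriorPower.ιMulti ℝ (k + 1) (Matrix.vecCons ⁅a, b⁆ z) := rfl
  have h' (a b : 𝔤) (z : Fin k → 𝔤) :
      lieBoundaryAux 𝔤 k b a z = -lieBoundaryAux 𝔤 k a b z := by
    rw [h, h, ← lie_skew b a, ← neg_one_smul ℝ ⁅a, b⁆]
    exact ((exteriorPower.ιMulti ℝ (k + 1)).map_vecCons_smul z (-1 : ℝ) ⁅a, b⁆).trans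
      (neg_one_smul ℝ _)
  rw [h' (x i.castSucc) (x j.succ), h, sub_neg_eq_add, ← two_smul ℝ, smul_comm, smul_smul,
    ← Int.cast_smul_eq_zsmul ℝ, smul_smul]
  congr 1
  simp only [Fin.val_castSucc, Fin.val_succ]
  push_cast
  ring

/-- The homology differential as an alternating map of `k + 2` arguments. -/
def lieBoundaryAlt (k : ℕ) : 𝔤 [⋀^Fin (k + 2)]→ₗ[ℝ] ⋀[ℝ]^(k + 1) 𝔤 where
  toFun := lieBoundaryFun 𝔤 k
  map_update_add' := by
    intro _ x i a b
    simp only [lieBoundaryFun_eq]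
    rw [AlternatingMap.map_update_add, smul_add]
  map_update_smul' := by
    intro _ x i a b
    simp only [lieBoundaryFun_eq]
    rw [AlternatingMap.map_update_smul, smul_comm]
  map_eq_zero_of_eq' := by
    intro x i j h hij
    simp only [lieBoundaryFun_eq]
    rw [AlternatingMap.map_eq_zero_of_eq _ _ h hij, smul_zero]

/-- The Lie algebra homology differential `∂_{k+1} : Λ^{k+1} 𝔤 → Λ^k 𝔤`. -/
def lieBoundary : (k : ℕ) → ⋀[ℝ]^(k + 1) 𝔤 →ₗ[ℝ] ⋀[ℝ]^k 𝔤
  | 0 => 0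
  | k + 1 => exteriorPower.alternatingMapLinearEquiv (lieBoundaryAlt 𝔤 k)

/-- The cycles `Z_{k+1}(𝔤) = ker ∂_{k+1}`. -/
def lieCycles (k : ℕ) : Submodule ℝ (⋀[ℝ]^(k + 1) 𝔤) := LinearMap.ker (lieBoundary 𝔤 k)

end LieHomology

/-! ## Infinitesimal actions and co-momentum maps

Throughout `n = m + 1`, so that `ω` has degree `n + 1 = m + 2` and `H` has degree `n - 1 = m`. -/

section Actions

variable {E : Type*} [NormedAddCommGroup E] [NormedSpace ℝ E]
  {M : Type*} [TopologicalSpace M] [ChartedSpace E M]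
  [IsManifold 𝓘(ℝ, E) ((⊤ : ℕ∞) : WithTop ℕ∞) M]
  {𝔤 : Type*} [LieRing 𝔤] [LieAlgebra ℝ 𝔤] {m : ℕ}

/-- `v : 𝔤 → 𝔛(M)` is an infinitesimal action: a homomorphism of Lie algebras. -/
def IsInfinitesimalAction (v : 𝔤 →ₗ[ℝ] SmoothVectorField E M) : Prop :=
  ∀ x y : 𝔤, (v ⁅x, y⁆ : ∀ z : M, TangentSpace 𝓘(ℝ, E) z) =
    VectorField.mlieBracket 𝓘(ℝ, E) (v x) (v y)

/-- The infinitesimal action preserves `ω`. -/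
def IsMultisymplecticAction (ω : FormField E M (m + 2))
    (v : 𝔤 →ₗ[ℝ] SmoothVectorField E M) : Prop :=
  ∀ x : 𝔤, ω.lieDeriv (v x) = 0

/-- `L_{v_x} H` is closed for all `x`. -/
def IsLocallyPreserving (H : FormField E M m) (v : 𝔤 →ₗ[ℝ] SmoothVectorField E M) : Prop :=
  ∀ x : 𝔤, IsClosedForm (H.lieDeriv (v x))

/-- `L_{v_x} H` is exact for all `x`. -/
def IsGloballyPreserving (H : FormField E M m) (v : 𝔤 →ₗ[ℝ] SmoothVectorField E M) : Prop :=
  ∀ x : 𝔤, IsExactForm (H.lieDeriv (v x))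

/-- The sign `ς(k) = -(-1)^{k(k+1)/2}`. -/
def multiSign (k : ℕ) : ℝ := -(-1) ^ (k * (k + 1) / 2)

variable (E M 𝔤) in
/-- Families of linear maps `f_k : Λ^k 𝔤 → Ω^{n-k}(M)`; the form degree `j = n - k` is an explicit
index, subject to `k + j = n`. -/
abbrev MomentumComponents (n : ℕ) :=
  ∀ k j : ℕ, k + j = n → (⋀[ℝ]^k 𝔤 →ₗ[ℝ] SmoothForm E M j)

/-- `(f)` is a homotopy co-momentum map for the action `v` on `(M, ω)`, `n = m + 1`.
The component `f₀` is zero by convention; the component `f_{n+1}`, zero as well, is omitted. As both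
sides of the structure equation
`-f_{k-1}(∂p) = d f_k(p) + ς(k) ι(v_p) ω` are linear in `p`,
it is stated for the generators `p = x₁ ∧ ⋯ ∧ x_k`. -/
structure IsCoMomentumMap (ω : FormField E M (m + 2)) (v : 𝔤 →ₗ[ℝ] SmoothVectorField E M)
    (f : MomentumComponents E M 𝔤 (m + 1)) : Prop where
  zero_component : f 0 (m + 1) (Nat.zero_add _) = 0
  hamiltonian : ∀ x : ⋀[ℝ]^1 𝔤, ∃ V : SmoothVectorField E M,
    IsHamiltonianVectorField ω (f 1 m (Nat.add_comm 1 m) x : FormField E M m) V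
  /-- The structure equation for `1 ≤ k + 1 ≤ n`. -/
  structure_eq : ∀ (k j : ℕ) (h : k + 1 + j = m + 1) (x : Fin (k + 1) → 𝔤),
    -(f k (j + 1) (by omega) (lieBoundary 𝔤 k (exteriorPower.ιMulti ℝ (k + 1) x)) :
        FormField E M (j + 1)) =
      (f (k + 1) j h (exteriorPower.ιMulti ℝ (k + 1) x) : FormField E M j).d +
        multiSign (k + 1) • FormField.contractMulti (j := j + 1) (k + 1) (fun i => v (x i))
          (ω.castDeg (by omega))
  /-- The structure equation for `k = n + 1`. -/
  structure_eq_top : ∀ x : Fin (m + 2) → 𝔤,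
    -(f (m + 1) 0 rfl (lieBoundary 𝔤 (m + 1) (exteriorPower.ιMulti ℝ (m + 2) x)) :
        FormField E M 0) =
      multiSign (m + 2) • FormField.contractMulti (j := 0) (m + 2) (fun i => v (x i))
          (ω.castDeg (by omega))
  momentum : ∀ x : 𝔤, IsHamiltonianVectorField ω
    (f 1 m (Nat.add_comm 1 m) (exteriorPower.ιMulti ℝ 1 fun _ => x) : FormField E M m) (v x)

end Actions

/-- The manifold `ℝ³` with its coordinates `x = z 0`, `y = z 1`, `z = z 2`. -/
abbrev R3 := EuclideanSpace ℝ (Fin 3)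

end

/-!
Since `d` commutes with Lie derivatives, `f_k(p)` is locally conserved as soon as
`L_{v_H} d f_k(p) = 0`. By linearity in `p`, the structure equation reduces
`L_{v_H} (d f_k(p) + f_{k-1}(∂p)) = 0` to `L_{v_H} ι_{v_{x_k}} ⋯ ι_{v_{x_1}} ω = 0`, and `∂p = 0`
when `p` is a cycle. Commuting `L_{v_H}` past a contraction with `v_x` produces the bracket
`[v_H, v_x]`, so it remains to see that `L_{v_H} ω = 0`, which is Cartan's formula, and that
`ι_{[v_H, v_x]} ω = 0`, which results from applying `L_{v_x}` to `ι_{v_H} ω = -dH`, because `ω` is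
invariant and `L_{v_x} H` is closed.
-/

noncomputable section

open ContinuousAlternatingMap VectorField Filter
open scoped Topology

section NormedSpace

open scoped ContDiff

variable {𝕜 E F G : Type*} [NontriviallyNormedField 𝕜] [NormedAddCommGroup E] [NormedSpace 𝕜 E]
  [NormedAddCommGroup F] [NormedSpace 𝕜 F] [NormedAddCommGroup G] [NormedSpace 𝕜 G] {k : ℕ}

variable (𝕜 E F k) in
/-- The interior product `(v, a) ↦ ι_v a` of alternating forms with vectors, as a continuous
bilinear map. -/
def interiorProductL : E →L[𝕜] (E [⋀^Fin (k + 1)]→L[𝕜] F) →L[𝕜] (E [⋀^Fin k]→L[𝕜] F) :=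
  (curryLeftLI (𝕜 := 𝕜) (E := E) (F := F) (n := k)).toContinuousLinearMap.flip

theorem fderiv_curryLeft_apply {V : G → E} {α : G → E [⋀^Fin (k + 1)]→L[𝕜] F} {y : G}
    (hV : DifferentiableAt 𝕜 V y) (hα : DifferentiableAt 𝕜 α y) (h : G) :
    fderiv 𝕜 (fun z => (α z).curryLeft (V z)) y h =
      (α y).curryLeft (fderiv 𝕜 V y h) + (fderiv 𝕜 α y h).curryLeft (V y) := by
  have hfderiv := ((interiorProductL 𝕜 E F k).hasFDerivAt_of_bilinear hV.hasFDerivAt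
    hα.hasFDerivAt).fderiv
  exact (DFunLike.congr_fun hfderiv h).trans (add_comm _ _)

theorem contDiffOn_curryLeft {V : G → E} {α : G → E [⋀^Fin (k + 1)]→L[𝕜] F} {s : Set G}
    {r : ℕ∞ω} (hV : ContDiffOn 𝕜 r V s) (hα : ContDiffOn 𝕜 r α s) :
    ContDiffOn 𝕜 r (fun z => (α z).curryLeft (V z)) s :=
  (interiorProductL 𝕜 E F k).isBoundedBilinearMap.contDiff.comp_contDiffOn (hV.prodMk hα)

theorem contDiffOn_extDeriv {α : E → E [⋀^Fin k]→L[𝕜] F} {s : Set E} {q r : ℕ∞ω}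
    (hs : IsOpen s) (hα : ContDiffOn 𝕜 r α s) (hqr : q + 1 ≤ r) :
    ContDiffOn 𝕜 q (extDeriv α) s := by
  have contDiff_alternatize : ContDiff 𝕜 q fun a => alternatizeUncurryFinCLM (n := k) 𝕜 E F a :=
    ContinuousLinearMap.contDiff _
  exact contDiff_alternatize.comp_contDiffOn (hα.fderiv_of_isOpen hs hqr)

theorem curryLeft_curryLeft_swap (a : E [⋀^Fin (k + 2)]→L[𝕜] F) (u v : E) :
    (a.curryLeft u).curryLeft v = -(a.curryLeft v).curryLeft u := by
  have h := curryLeft_same a (u + v)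
  simp only [map_add, curryLeft_add, _root_.add_apply, curryLeft_same, zero_add, add_zero] at h
  exact eq_neg_of_add_eq_zero_right h

theorem curryLeft_fderivCompContinuousLinearMap (a : F [⋀^Fin (k + 1)]→L[𝕜] G)
    (g T : E →L[𝕜] F) (v : E) :
    (a.fderivCompContinuousLinearMap g T).curryLeft v =
      (a.curryLeft (T v)).compContinuousLinearMap g +
        (a.curryLeft (g v)).fderivCompContinuousLinearMap g T := by
  ext w
  have update_zero : (fun j => (Function.update (fun _ => g) 0 T j) (Matrix.vecCons v w j)) =
      Matrix.vecCons (T v) (g ∘ w) := by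
    ext j
    cases j using Fin.cases <;> simp
  have update_succ (i : Fin k) :
      (fun j => (Function.update (fun _ => g) i.succ T j) (Matrix.vecCons v w j)) =
        Matrix.vecCons (g v) fun j => (Function.update (fun _ => g) i T j) (w j) := by
    ext j
    cases j using Fin.cases <;> simp [Function.update_apply, (Fin.succ_ne_zero i).symm]
  simp only [ContinuousAlternatingMap.add_apply, curryLeft_apply_apply,
    compContinuousLinearMap_apply, fderivCompContinuousLinearMap_apply, Fin.sum_univ_succ,
    update_zero, update_succ]

end NormedSpace

theorem removeNth_succ_vecCons {α : Type*} {k : ℕ} (i : Fin (k + 1)) (a : α)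
    (w : Fin (k + 1) → α) :
    i.succ.removeNth (Matrix.vecCons a w) = Matrix.vecCons a (i.removeNth w) := by
  ext j
  cases j using Fin.cases <;> simp [Fin.removeNth]

namespace FormField

section LieDerivModel

variable {E : Type*} [NormedAddCommGroup E] [NormedSpace ℝ E] {k : ℕ} {V W : E → E} {y : E}

theorem lieDerivModel_congr {α β : E → E [⋀^Fin k]→L[ℝ] ℝ} (hV : V =ᶠ[𝓝 y] W)
    (hα : α =ᶠ[𝓝 y] β) : lieDerivModel V α y = lieDerivModel W β y := by
  simp only [lieDerivModel, hV.fderiv_eq, hα.fderiv_eq, hV.eq_of_nhds, hα.eq_of_nhds]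

theorem lieDerivModel_add {α β : E → E [⋀^Fin k]→L[ℝ] ℝ} (hα : DifferentiableAt ℝ α y)
    (hβ : DifferentiableAt ℝ β y) :
    lieDerivModel V (α + β) y = lieDerivModel V α y + lieDerivModel V β y := by
  ext w
  simp only [lieDerivModel, fderiv_add hα hβ, ContinuousAlternatingMap.add_apply, Pi.add_apply,
    _root_.add_apply, fderivCompContinuousLinearMap_apply, Finset.sum_add_distrib]
  abel

theorem lieDerivModel_smul (c : ℝ) (α : E → E [⋀^Fin k]→L[ℝ] ℝ) :
    lieDerivModel V (c • α) y = c • lieDerivModel V α y := by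
  ext w
  rw [lieDerivModel, fderiv_const_smul_field (𝕜 := ℝ) (f := α) c]
  simp only [lieDerivModel, ContinuousAlternatingMap.add_apply,
    Pi.smul_apply, _root_.smul_apply, ContinuousAlternatingMap.smul_apply,
    fderivCompContinuousLinearMap_apply, ← Finset.smul_sum, smul_add]

theorem lieDerivModel_eq_curryLeft_extDeriv (V : E → E) (α : E → E [⋀^Fin 0]→L[ℝ] ℝ) (y : E) :
    lieDerivModel V α y = (extDeriv α y).curryLeft (V y) := by
  ext w
  simp [lieDerivModel, extDeriv, alternatizeUncurryFin_apply,
    fderivCompContinuousLinearMap_of_isEmpty]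

theorem lieDerivModel_eq_extDeriv_curryLeft_add {α : E → E [⋀^Fin (k + 1)]→L[ℝ] ℝ}
    (hV : DifferentiableAt ℝ V y) (hα : DifferentiableAt ℝ α y) :
    lieDerivModel V α y = extDeriv (fun z => (α z).curryLeft (V z)) y +
      (extDeriv α y).curryLeft (V y) := by
  ext w
  rw [lieDerivModel, fderivCompContinuousLinearMap_eq_alternatizeUncurryFin]
  simp only [extDeriv, ContinuousAlternatingMap.add_apply, curryLeft_apply_apply,
    alternatizeUncurryFin_apply, fderiv_curryLeft_apply hV hα, ContinuousLinearMap.comp_apply,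
    alternatizeUncurryFinCLM_apply, ContinuousLinearMap.postcomp_apply]
  rw [Fin.sum_univ_succ (n := k + 1)]
  simp [pow_succ, Finset.sum_add_distrib, removeNth_succ_vecCons]
  ring

theorem lieDerivModel_curryLeft {α : E → E [⋀^Fin (k + 1)]→L[ℝ] ℝ}
    (hW : DifferentiableAt ℝ W y) (hα : DifferentiableAt ℝ α y) :
    lieDerivModel V (fun z => (α z).curryLeft (W z)) y =
      (lieDerivModel V α y).curryLeft (W y) + (α y).curryLeft (lieBracket ℝ V W y) := by
  rw [lieDerivModel, lieDerivModel, fderiv_curryLeft_apply hW hα,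
    curryLeft_add, _root_.add_apply, curryLeft_fderivCompContinuousLinearMap,
    lieBracket, map_sub, ContinuousLinearMap.id_apply]
  have comp_id (a : E [⋀^Fin k]→L[ℝ] ℝ) : a.compContinuousLinearMap (.id ℝ E) = a := rfl
  rw [comp_id]
  abel

end LieDerivModel

end FormField

section Charts

open scoped ContDiff

theorem minSmoothness_two_le_infty : minSmoothness ℝ 2 ≤ ∞ := by
  simpa using WithTop.coe_le_coe.2 (le_top (a := (2 : ℕ∞)))

variable {E : Type*} [NormedAddCommGroup E] [NormedSpace ℝ E]
  {M : Type*} [TopologicalSpace M] [ChartedSpace E M] {k : ℕ}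

/-- The derivative of the inverse of the preferred chart at `x₀`, read as an endomorphism of the
model space. -/
def chartSymmDeriv (x₀ : M) (y : E) : E →L[ℝ] E :=
  mfderiv 𝓘(ℝ, E) 𝓘(ℝ, E) (extChartAt 𝓘(ℝ, E) x₀).symm y

/-- The coordinate expression of a vector field in the preferred chart at `x₀`: its pullback under
the inverse of the chart. -/
def fieldInChart (x₀ : M) (V : ∀ x : M, TangentSpace 𝓘(ℝ, E) x) (y : E) : E :=
  mpullback 𝓘(ℝ, E) 𝓘(ℝ, E) (extChartAt 𝓘(ℝ, E) x₀).symm V y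

namespace FormField

theorem inChart_apply (x₀ : M) (α : FormField E M k) (y : E) (w : Fin k → E) :
    inChart x₀ α y w = α ((extChartAt 𝓘(ℝ, E) x₀).symm y) fun i => chartSymmDeriv x₀ y (w i) :=
  rfl

theorem apply_congr_point (α : FormField E M k) {x y : M} (h : x = y) (w : Fin k → E) :
    α x w = α y w := by
  subst h
  rfl

theorem IsSmooth.differentiableAt {α : FormField E M k} (hα : α.IsSmooth) (x₀ : M) :
    DifferentiableAt ℝ (inChart x₀ α) (extChartAt 𝓘(ℝ, E) x₀ x₀) :=
  ((hα x₀).contDiffAt (extChartAt_target_mem_nhds x₀)).differentiableAt (by simp)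

end FormField

variable [IsManifold 𝓘(ℝ, E) ∞ M]

theorem chartSymmDeriv_self (x₀ : M) :
    chartSymmDeriv x₀ (extChartAt 𝓘(ℝ, E) x₀ x₀) = .id ℝ E := by
  have h := mfderivWithin_extChartAt_symm_comp_mfderiv_extChartAt' (I := 𝓘(ℝ, E))
    (mem_extChartAt_source x₀)
  rwa [mfderiv_extChartAt_self, ModelWithCorners.range_eq_univ, mfderivWithin_univ] at h

theorem isInvertible_chartSymmDeriv {x₀ : M} {y : E} (hy : y ∈ (extChartAt 𝓘(ℝ, E) x₀).target) :
    (chartSymmDeriv x₀ y).IsInvertible := by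
  have h := isInvertible_mfderivWithin_extChartAt_symm (I := 𝓘(ℝ, E)) hy
  rwa [ModelWithCorners.range_eq_univ, mfderivWithin_univ] at h

theorem mdifferentiableAt_extChartAt_symm {x₀ : M} {y : E}
    (hy : y ∈ (extChartAt 𝓘(ℝ, E) x₀).target) :
    MDifferentiableAt 𝓘(ℝ, E) 𝓘(ℝ, E) (extChartAt 𝓘(ℝ, E) x₀).symm y := by
  have h := mdifferentiableWithinAt_extChartAt_symm (I := 𝓘(ℝ, E)) hy
  rwa [ModelWithCorners.range_eq_univ, mdifferentiableWithinAt_univ] at h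

theorem chartSymmDeriv_fieldInChart {x₀ : M} {y : E} (hy : y ∈ (extChartAt 𝓘(ℝ, E) x₀).target)
    (V : ∀ x : M, TangentSpace 𝓘(ℝ, E) x) :
    chartSymmDeriv x₀ y (fieldInChart x₀ V y) = V ((extChartAt 𝓘(ℝ, E) x₀).symm y) :=
  (isInvertible_chartSymmDeriv hy).self_apply_inverse _

theorem fieldInChart_self (x₀ : M) (V : ∀ x : M, TangentSpace 𝓘(ℝ, E) x) :
    fieldInChart x₀ V (extChartAt 𝓘(ℝ, E) x₀ x₀) = V x₀ := by
  have h := chartSymmDeriv_fieldInChart (mem_extChartAt_target x₀) V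
  rw [chartSymmDeriv_self, extChartAt_to_inv x₀] at h
  exact h

theorem fieldInChart_eq_trivializationAt {x₀ : M} {y : E}
    (hy : y ∈ (extChartAt 𝓘(ℝ, E) x₀).target) (V : ∀ x : M, TangentSpace 𝓘(ℝ, E) x) :
    fieldInChart x₀ V y = (trivializationAt E (TangentSpace 𝓘(ℝ, E)) x₀
      ⟨(extChartAt 𝓘(ℝ, E) x₀).symm y, V ((extChartAt 𝓘(ℝ, E) x₀).symm y)⟩).2 := by
  set x := (extChartAt 𝓘(ℝ, E) x₀).symm y
  have hx : x ∈ (chartAt E x₀).source :=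
    extChartAt_source 𝓘(ℝ, E) x₀ ▸ (extChartAt 𝓘(ℝ, E) x₀).map_target hy
  have mfderiv_chart_comp := mfderiv_extChartAt_comp_mfderivWithin_extChartAt_symm
    (I := 𝓘(ℝ, E)) hy
  rw [ModelWithCorners.range_eq_univ, mfderivWithin_univ] at mfderiv_chart_comp
  have mfderiv_chart : mfderiv 𝓘(ℝ, E) 𝓘(ℝ, E) (extChartAt 𝓘(ℝ, E) x₀) x (V x) =
      fieldInChart x₀ V y := by
    rw [← chartSymmDeriv_fieldInChart hy V]
    exact DFunLike.congr_fun mfderiv_chart_comp (fieldInChart x₀ V y)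
  rw [← mfderiv_chart, ← TangentBundle.continuousLinearMapAt_trivializationAt hx]
  exact congrFun ((trivializationAt E (TangentSpace 𝓘(ℝ, E)) x₀).coe_linearMapAt_of_mem
    (R := ℝ) (b := x) hx) (V x)

theorem contDiffOn_fieldInChart (x₀ : M) (V : SmoothVectorField E M) :
    ContDiffOn ℝ ∞ (fieldInChart x₀ V) (extChartAt 𝓘(ℝ, E) x₀).target := by
  have smooth_coordinates := (Bundle.Trivialization.contMDiffOn_section_baseSet_iff
    (trivializationAt E (TangentSpace 𝓘(ℝ, E)) x₀)).1 V.contMDiff.contMDiffOn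
  have maps_to_baseSet : (extChartAt 𝓘(ℝ, E) x₀).target ⊆ (extChartAt 𝓘(ℝ, E) x₀).symm ⁻¹'
      (trivializationAt E (TangentSpace 𝓘(ℝ, E)) x₀).baseSet := fun y hy => by
    simpa using (extChartAt 𝓘(ℝ, E) x₀).map_target hy
  exact (smooth_coordinates.comp (contMDiffOn_extChartAt_symm x₀) maps_to_baseSet).contDiffOn.congr
    fun y hy => fieldInChart_eq_trivializationAt hy V

theorem differentiableAt_fieldInChart (x₀ : M) (V : SmoothVectorField E M) :
    DifferentiableAt ℝ (fieldInChart x₀ V) (extChartAt 𝓘(ℝ, E) x₀ x₀) :=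
  ((contDiffOn_fieldInChart x₀ V).contDiffAt (extChartAt_target_mem_nhds x₀)).differentiableAt
    (by simp)

theorem mlieBracket_eq_lieBracket_fieldInChart (V W : ∀ x : M, TangentSpace 𝓘(ℝ, E) x) (x : M) :
    mlieBracket 𝓘(ℝ, E) V W x =
      lieBracket ℝ (fieldInChart x V) (fieldInChart x W) (extChartAt 𝓘(ℝ, E) x x) := by
  rw [mlieBracket, mlieBracketWithin_def]
  simp only [mpullback, mfderiv_extChartAt_self, ModelWithCorners.range_eq_univ,
    Set.preimage_univ, Set.univ_inter, mpullbackWithin_univ]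
  change (ContinuousLinearMap.id ℝ E).inverse (lieBracketWithin ℝ (fieldInChart x V)
    (fieldInChart x W) Set.univ (extChartAt 𝓘(ℝ, E) x x)) = _
  rw [ContinuousLinearMap.inverse_id, lieBracketWithin_univ]
  rfl

theorem contDiffAt_extChartAt_comp_symm (x : M) {x₀ : M} {y : E}
    (hy : y ∈ (extChartAt 𝓘(ℝ, E) x₀).target)
    (hx : (extChartAt 𝓘(ℝ, E) x₀).symm y ∈ (extChartAt 𝓘(ℝ, E) x).source) :
    ContDiffAt ℝ ∞ (extChartAt 𝓘(ℝ, E) x ∘ (extChartAt 𝓘(ℝ, E) x₀).symm) y := by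
  have h := contDiffWithinAt_ext_coord_change (I := 𝓘(ℝ, E)) (n := ∞) x x₀ (y := y)
    (by rw [PartialEquiv.trans_source]; exact ⟨hy, hx⟩)
  rwa [ModelWithCorners.range_eq_univ, contDiffWithinAt_univ] at h

theorem chartSymmDeriv_eq_comp {x₀ x : M} {y : E} (hy : y ∈ (extChartAt 𝓘(ℝ, E) x₀).target)
    (hx : (extChartAt 𝓘(ℝ, E) x₀).symm y ∈ (extChartAt 𝓘(ℝ, E) x).source) :
    chartSymmDeriv x₀ y =
      chartSymmDeriv x (extChartAt 𝓘(ℝ, E) x ((extChartAt 𝓘(ℝ, E) x₀).symm y)) ∘L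
        fderiv ℝ (extChartAt 𝓘(ℝ, E) x ∘ (extChartAt 𝓘(ℝ, E) x₀).symm) y := by
  have symm_eventuallyEq : (extChartAt 𝓘(ℝ, E) x₀).symm =ᶠ[𝓝 y] (extChartAt 𝓘(ℝ, E) x).symm ∘
      (extChartAt 𝓘(ℝ, E) x ∘ (extChartAt 𝓘(ℝ, E) x₀).symm) := by
    filter_upwards [(mdifferentiableAt_extChartAt_symm hy).continuousAt.preimage_mem_nhds
      ((isOpen_extChartAt_source x).mem_nhds hx)] with z hz
    exact ((extChartAt 𝓘(ℝ, E) x).left_inv hz).symm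
  have h := symm_eventuallyEq.mfderiv_eq (I := 𝓘(ℝ, E)) (I' := 𝓘(ℝ, E))
  rwa [mfderiv_comp y (I' := 𝓘(ℝ, E))
    (mdifferentiableAt_extChartAt_symm ((extChartAt 𝓘(ℝ, E) x).map_source hx))
    ((contDiffAt_extChartAt_comp_symm x hy hx).differentiableAt (by simp)).mdifferentiableAt,
    mfderiv_eq_fderiv] at h

namespace FormField

theorem ofChart_eq (x₀ : M) (β : E [⋀^Fin k]→L[ℝ] ℝ) : ofChart x₀ β = β := by
  ext w
  rw [ofChart, mfderiv_extChartAt_self]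
  rfl

theorem inChart_self (x₀ : M) (α : FormField E M k) :
    inChart x₀ α (extChartAt 𝓘(ℝ, E) x₀ x₀) = α x₀ := by
  ext w
  rw [inChart_apply, chartSymmDeriv_self]
  exact α.apply_congr_point (extChartAt_to_inv x₀) w

theorem inChart_contract {x₀ : M} {y : E} (hy : y ∈ (extChartAt 𝓘(ℝ, E) x₀).target)
    (V : ∀ x : M, TangentSpace 𝓘(ℝ, E) x) (α : FormField E M (k + 1)) :
    inChart x₀ (contract V α) y = (inChart x₀ α y).curryLeft (fieldInChart x₀ V y) := by
  let a : E [⋀^Fin (k + 1)]→L[ℝ] ℝ := α ((extChartAt 𝓘(ℝ, E) x₀).symm y)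
  change (a.curryLeft (V _ : E)).compContinuousLinearMap (chartSymmDeriv x₀ y) =
    (a.compContinuousLinearMap (chartSymmDeriv x₀ y)).curryLeft (fieldInChart x₀ V y)
  rw [curryLeft_compContinuousLinearMap, chartSymmDeriv_fieldInChart hy]

theorem inChart_eq_compContinuousLinearMap_fderiv (α : FormField E M k) {x₀ x : M} {y : E}
    (hy : y ∈ (extChartAt 𝓘(ℝ, E) x₀).target)
    (hx : (extChartAt 𝓘(ℝ, E) x₀).symm y ∈ (extChartAt 𝓘(ℝ, E) x).source) :
    inChart x₀ α y =
      (inChart x α (extChartAt 𝓘(ℝ, E) x ((extChartAt 𝓘(ℝ, E) x₀).symm y))).compContinuousLinearMap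
        (fderiv ℝ (extChartAt 𝓘(ℝ, E) x ∘ (extChartAt 𝓘(ℝ, E) x₀).symm) y) := by
  ext w
  rw [compContinuousLinearMap_apply, inChart_apply, inChart_apply, chartSymmDeriv_eq_comp hy hx]
  exact α.apply_congr_point ((extChartAt 𝓘(ℝ, E) x).left_inv hx).symm _

theorem d_apply (α : FormField E M k) (x : M) :
    α.d x = extDeriv (inChart x α) (extChartAt 𝓘(ℝ, E) x x) :=
  ofChart_eq x _

theorem lieDeriv_apply (V : ∀ x : M, TangentSpace 𝓘(ℝ, E) x) (α : FormField E M k) (x : M) :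
    α.lieDeriv V x = lieDerivModel (fieldInChart x V) (inChart x α) (extChartAt 𝓘(ℝ, E) x x) :=
  ofChart_eq x _

theorem inChart_d {x₀ : M} {y : E} (hy : y ∈ (extChartAt 𝓘(ℝ, E) x₀).target)
    {α : FormField E M k} (hα : α.IsSmooth) :
    inChart x₀ α.d y = extDeriv (inChart x₀ α) y := by
  set x := (extChartAt 𝓘(ℝ, E) x₀).symm y
  set τ := extChartAt 𝓘(ℝ, E) x ∘ (extChartAt 𝓘(ℝ, E) x₀).symm
  have hx : x ∈ (extChartAt 𝓘(ℝ, E) x).source := mem_extChartAt_source x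
  have inChart_eventuallyEq : inChart x₀ α =ᶠ[𝓝 y] fun z =>
      (inChart x α (τ z)).compContinuousLinearMap (fderiv ℝ τ z) := by
    filter_upwards [(isOpen_extChartAt_target x₀).mem_nhds hy,
      (mdifferentiableAt_extChartAt_symm hy).continuousAt.preimage_mem_nhds
        ((isOpen_extChartAt_source x).mem_nhds hx)] with z hz hzx
    exact α.inChart_eq_compContinuousLinearMap_fderiv hz hzx
  have differentiableAt_inChart : DifferentiableAt ℝ (inChart x α) (τ y) := hα.differentiableAt x
  rw [inChart_eventuallyEq.extDeriv_eq, extDeriv_pullback differentiableAt_inChart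
    (contDiffAt_extChartAt_comp_symm x hy hx) minSmoothness_two_le_infty,
    inChart_eq_compContinuousLinearMap_fderiv _ hy hx, inChart_self, d_apply]
  rfl

end FormField

end Charts

namespace FormField

section Calculus

open scoped ContDiff

variable {E : Type*} [NormedAddCommGroup E] [NormedSpace ℝ E]
  {M : Type*} [TopologicalSpace M] [ChartedSpace E M] {k : ℕ}

theorem inChart_add (x₀ : M) (α β : FormField E M k) :
    inChart x₀ (α + β) = inChart x₀ α + inChart x₀ β :=
  rfl

theorem inChart_smul (x₀ : M) (c : ℝ) (α : FormField E M k) :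
    inChart x₀ (c • α) = c • inChart x₀ α :=
  rfl

theorem contract_contract (V W : ∀ x : M, TangentSpace 𝓘(ℝ, E) x) (α : FormField E M (k + 2)) :
    contract V (contract W α) = -contract W (contract V α) :=
  funext fun x => curryLeft_curryLeft_swap (E := E) (α x) (W x) (V x)

theorem contract_zero (V : ∀ x : M, TangentSpace 𝓘(ℝ, E) x) :
    contract V (0 : FormField E M (k + 1)) = 0 :=
  rfl

theorem contract_neg_field (V : ∀ x : M, TangentSpace 𝓘(ℝ, E) x) (α : FormField E M (k + 1)) :
    contract (-V) α = -contract V α :=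
  funext fun x => map_neg (curryLeft (E := E) (α x)) (V x)

variable [IsManifold 𝓘(ℝ, E) ∞ M] {α β : FormField E M k} (V : SmoothVectorField E M)

theorem inChart_d_eventuallyEq (hα : α.IsSmooth) (x₀ : M) :
    inChart x₀ α.d =ᶠ[𝓝 (extChartAt 𝓘(ℝ, E) x₀ x₀)] extDeriv (inChart x₀ α) :=
  eventually_of_mem (extChartAt_target_mem_nhds x₀) fun _ hy => inChart_d hy hα

theorem inChart_contract_eventuallyEq (V : ∀ x : M, TangentSpace 𝓘(ℝ, E) x)
    (α : FormField E M (k + 1)) (x₀ : M) :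
    inChart x₀ (contract V α) =ᶠ[𝓝 (extChartAt 𝓘(ℝ, E) x₀ x₀)]
      fun y => (inChart x₀ α y).curryLeft (fieldInChart x₀ V y) :=
  eventually_of_mem (extChartAt_target_mem_nhds x₀) fun _ hy => inChart_contract hy V α

theorem IsSmooth.d (hα : α.IsSmooth) : α.d.IsSmooth := fun x₀ =>
  (contDiffOn_extDeriv (isOpen_extChartAt_target x₀) (hα x₀) (by simp)).congr
    fun _ hy => inChart_d hy hα

theorem IsSmooth.contract {α : FormField E M (k + 1)} (hα : α.IsSmooth) :
    (α.contract V).IsSmooth := fun x₀ =>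
  (contDiffOn_curryLeft (contDiffOn_fieldInChart x₀ V) (hα x₀)).congr
    fun _ hy => inChart_contract hy _ α

theorem d_add (hα : α.IsSmooth) (hβ : β.IsSmooth) : (α + β).d = α.d + β.d := by
  funext x
  rw [Pi.add_apply, d_apply, d_apply, d_apply, inChart_add,
    extDeriv_add (hα.differentiableAt x) (hβ.differentiableAt x)]
  rfl

theorem d_smul (c : ℝ) (α : FormField E M k) : (c • α).d = c • α.d := by
  funext x
  rw [Pi.smul_apply, d_apply, d_apply, inChart_smul, extDeriv_smul]
  rfl

theorem d_neg (α : FormField E M k) : (-α).d = -α.d :=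
  (congrArg FormField.d (neg_one_smul ℝ α)).symm.trans
    ((d_smul (-1) α).trans (neg_one_smul ℝ α.d))

theorem d_d (hα : α.IsSmooth) : α.d.d = 0 := by
  funext x
  rw [d_apply, (inChart_d_eventuallyEq hα x).extDeriv_eq]
  exact extDeriv_extDeriv_apply
    ((hα x).contDiffAt (extChartAt_target_mem_nhds x)) minSmoothness_two_le_infty

theorem lieDeriv_add (V : ∀ x : M, TangentSpace 𝓘(ℝ, E) x) (hα : α.IsSmooth)
    (hβ : β.IsSmooth) :
    (α + β).lieDeriv V = α.lieDeriv V + β.lieDeriv V := by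
  funext x
  rw [Pi.add_apply, lieDeriv_apply, lieDeriv_apply, lieDeriv_apply, inChart_add,
    lieDerivModel_add (hα.differentiableAt x) (hβ.differentiableAt x)]
  rfl

theorem lieDeriv_smul (V : ∀ x : M, TangentSpace 𝓘(ℝ, E) x) (c : ℝ) (α : FormField E M k) :
    (c • α).lieDeriv V = c • α.lieDeriv V := by
  funext x
  rw [Pi.smul_apply, lieDeriv_apply, lieDeriv_apply, inChart_smul, lieDerivModel_smul]
  rfl

theorem lieDeriv_neg (V : ∀ x : M, TangentSpace 𝓘(ℝ, E) x) (α : FormField E M k) :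
    (-α).lieDeriv V = -α.lieDeriv V :=
  (congrArg (FormField.lieDeriv V) (neg_one_smul ℝ α)).symm.trans
    ((lieDeriv_smul V (-1) α).trans (neg_one_smul ℝ (α.lieDeriv V)))

theorem lieDeriv_eq_contract_d (V : ∀ x : M, TangentSpace 𝓘(ℝ, E) x) {α : FormField E M 0}
    (hα : α.IsSmooth) : α.lieDeriv V = α.d.contract V := by
  funext x
  rw [lieDeriv_apply, lieDerivModel_eq_curryLeft_extDeriv,
    ← inChart_d (mem_extChartAt_target x) hα, inChart_self, fieldInChart_self]
  rfl

theorem lieDeriv_eq_d_contract_add {α : FormField E M (k + 1)} (hα : α.IsSmooth) :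
    α.lieDeriv V = (α.contract V).d + α.d.contract V := by
  funext x
  rw [Pi.add_apply, lieDeriv_apply, lieDerivModel_eq_extDeriv_curryLeft_add
    (differentiableAt_fieldInChart x V) (hα.differentiableAt x), d_apply,
    (inChart_contract_eventuallyEq _ α x).extDeriv_eq, ← inChart_d (mem_extChartAt_target x) hα,
    inChart_self, fieldInChart_self]
  rfl

theorem IsSmooth.lieDeriv (hα : α.IsSmooth) : (α.lieDeriv V).IsSmooth := by
  cases k with
  | zero =>
    rw [lieDeriv_eq_contract_d V hα]
    exact hα.d.contract V
  | succ k =>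
    rw [lieDeriv_eq_d_contract_add V hα]
    exact (SmoothForm E M (k + 1)).add_mem (hα.contract V).d (hα.d.contract V)

theorem d_lieDeriv (hα : α.IsSmooth) : (α.lieDeriv V).d = α.d.lieDeriv V := by
  rw [lieDeriv_eq_d_contract_add V hα.d, d_d hα, contract_zero, add_zero]
  cases k with
  | zero => rw [lieDeriv_eq_contract_d V hα]
  | succ k =>
    rw [lieDeriv_eq_d_contract_add V hα, d_add (hα.contract V).d (hα.d.contract V),
      d_d (hα.contract V), zero_add]

theorem lieDeriv_contract (V : ∀ x : M, TangentSpace 𝓘(ℝ, E) x)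
    (W : SmoothVectorField E M) {α : FormField E M (k + 1)} (hα : α.IsSmooth) :
    (α.contract W).lieDeriv V =
      (α.lieDeriv V).contract W + α.contract (mlieBracket 𝓘(ℝ, E) V W) := by
  funext x
  rw [Pi.add_apply, lieDeriv_apply,
    lieDerivModel_congr .rfl (inChart_contract_eventuallyEq _ α x),
    lieDerivModel_curryLeft (differentiableAt_fieldInChart x W) (hα.differentiableAt x),
    ← lieDeriv_apply, inChart_self, fieldInChart_self, ← mlieBracket_eq_lieBracket_fieldInChart]
  rfl

theorem lieDeriv_contractMulti_eq_zero {V : ∀ x : M, TangentSpace 𝓘(ℝ, E) x}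
    {j k : ℕ} {W : Fin (k + 1) → SmoothVectorField E M} {α : FormField E M (j + (k + 1))}
    (hα : α.IsSmooth) (hV : α.lieDeriv V = 0)
    (hVW : ∀ i, contract (k := j + k) (mlieBracket 𝓘(ℝ, E) V (W i)) α = 0) :
    (contractMulti (k + 1) (fun i => W i) α).lieDeriv V = 0 := by
  have lieDeriv_contract_zero : (contract (k := j + k) (W 0) α).lieDeriv V = 0 := by
    rw [lieDeriv_contract (k := j + k) V (W 0) hα, hV, hVW 0, contract_zero, add_zero]
  induction k with
  | zero => exact lieDeriv_contract_zero
  | succ k ih =>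
    have bracket_contract (i : Fin (k + 1)) : contract (k := j + k)
        (mlieBracket 𝓘(ℝ, E) V (W i.succ)) (contract (k := j + (k + 1)) (W 0) α) = 0 := by
      rw [contract_contract (k := j + k), hVW i.succ, contract_zero, neg_zero]
    have smooth_contract := IsSmooth.contract (k := j + (k + 1)) (W 0) hα
    refine ih (W := fun i => W i.succ) smooth_contract lieDeriv_contract_zero bracket_contract ?_
    rw [lieDeriv_contract (k := j + k) V _ smooth_contract, lieDeriv_contract_zero,
      bracket_contract 0, contract_zero, add_zero]

theorem lieDeriv_contractMulti_castDeg_eq_zero {V : ∀ x : M, TangentSpace 𝓘(ℝ, E) x}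
    {j k l : ℕ} {W : Fin (k + 1) → SmoothVectorField E M} {α : FormField E M (l + 1)}
    (h : l + 1 = j + (k + 1)) (hα : α.IsSmooth) (hV : α.lieDeriv V = 0)
    (hVW : ∀ i, α.contract (mlieBracket 𝓘(ℝ, E) V (W i)) = 0) :
    (contractMulti (k + 1) (fun i => W i) (α.castDeg h)).lieDeriv V = 0 := by
  obtain rfl : l = j + k := by omega
  exact lieDeriv_contractMulti_eq_zero hα hV hVW

end Calculus

end FormField

section Conservation

variable {E : Type*} [NormedAddCommGroup E] [NormedSpace ℝ E]
  {M : Type*} [TopologicalSpace M] [ChartedSpace E M]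
  [IsManifold 𝓘(ℝ, E) ((⊤ : ℕ∞) : WithTop ℕ∞) M] {k m : ℕ}

namespace SmoothForm

variable (E M k) in
/-- The exterior derivative as a linear map on smooth forms. -/
def dₗ : SmoothForm E M k →ₗ[ℝ] SmoothForm E M (k + 1) where
  toFun α := ⟨α.1.d, FormField.IsSmooth.d α.2⟩
  map_add' α β := Subtype.ext (FormField.d_add α.2 β.2)
  map_smul' c α := Subtype.ext (FormField.d_smul c α.1)

variable (k) in
/-- The Lie derivative along `V` as a linear map on smooth forms. -/
def lieDerivₗ (V : SmoothVectorField E M) : SmoothForm E M k →ₗ[ℝ] SmoothForm E M k where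
  toFun α := ⟨α.1.lieDeriv V, FormField.IsSmooth.lieDeriv V α.2⟩
  map_add' α β := Subtype.ext (FormField.lieDeriv_add V α.2 β.2)
  map_smul' c α := Subtype.ext (FormField.lieDeriv_smul V c α.1)

end SmoothForm

theorem IsExactForm.isClosedForm {α : FormField E M k} (hα : IsExactForm α) :
    IsClosedForm α := by
  cases k with
  | zero =>
    obtain rfl : α = 0 := hα
    exact ⟨(SmoothForm E M 0).zero_mem, congrArg Subtype.val (map_zero (SmoothForm.dₗ E M 0))⟩
  | succ k =>
    obtain ⟨β, rfl⟩ := hα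
    exact ⟨FormField.IsSmooth.d β.2, FormField.d_d β.2⟩

namespace IsHamiltonianVectorField

variable {ω : FormField E M (m + 2)} {α : FormField E M m} {V : SmoothVectorField E M}

theorem lieDeriv_eq_zero (hV : IsHamiltonianVectorField ω α V) (hω : IsClosedForm ω)
    (hα : α.IsSmooth) : ω.lieDeriv V = 0 := by
  have contract_eq : ω.contract V = -α.d := by rw [hV, neg_neg]
  rw [FormField.lieDeriv_eq_d_contract_add V hω.1, hω.2, FormField.contract_zero, add_zero,
    contract_eq, FormField.d_neg, FormField.d_d hα, neg_zero]

theorem contract_mlieBracket_eq_zero (hV : IsHamiltonianVectorField ω α V) (hω : ω.IsSmooth)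
    (hα : α.IsSmooth) {W : SmoothVectorField E M} (hωW : ω.lieDeriv W = 0)
    (hαW : (α.lieDeriv W).d = 0) : ω.contract (mlieBracket 𝓘(ℝ, E) V W) = 0 := by
  have contract_eq : ω.contract V = -α.d := by rw [hV, neg_neg]
  have contract_bracket := FormField.lieDeriv_contract W V hω
  rw [contract_eq, FormField.lieDeriv_neg, ← FormField.d_lieDeriv W hα, hαW, neg_zero, hωW,
    FormField.contract_zero, zero_add] at contract_bracket
  rw [mlieBracket_swap, FormField.contract_neg_field, ← contract_bracket, neg_zero]

end IsHamiltonianVectorField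

namespace IsCoMomentumMap

variable {𝔤 : Type*} [LieRing 𝔤] [LieAlgebra ℝ 𝔤] {ω : FormField E M (m + 2)}
  {v : 𝔤 →ₗ[ℝ] SmoothVectorField E M} {f : MomentumComponents E M 𝔤 (m + 1)}

theorem lieDeriv_d_add_lieBoundary_eq_zero (hf : IsCoMomentumMap ω v f) (hω : ω.IsSmooth)
    {V : SmoothVectorField E M} (hωV : ω.lieDeriv V = 0)
    (hVv : ∀ x, ω.contract (mlieBracket 𝓘(ℝ, E) V (v x)) = 0) {k j : ℕ}
    (h : k + 1 + j = m + 1) (p : ⋀[ℝ]^(k + 1) 𝔤) :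
    FormField.lieDeriv V ((f (k + 1) j h p).1.d +
      (f k (j + 1) (by omega) (lieBoundary 𝔤 k p)).1) = 0 := by
  let defect : ⋀[ℝ]^(k + 1) 𝔤 →ₗ[ℝ] SmoothForm E M (j + 1) :=
    SmoothForm.dₗ E M j ∘ₗ f (k + 1) j h + f k (j + 1) (by omega) ∘ₗ lieBoundary 𝔤 k
  suffices SmoothForm.lieDerivₗ (j + 1) V ∘ₗ defect = 0 from
    congrArg Subtype.val (LinearMap.congr_fun this p)
  refine LinearMap.ext_on_range (exteriorPower.ιMulti_span ℝ (k + 1) 𝔤) fun x => Subtype.ext ?_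
  have defect_eq : (defect (exteriorPower.ιMulti ℝ (k + 1) x)).1 =
      -(multiSign (k + 1) • FormField.contractMulti (j := j + 1) (k + 1) (fun i => v (x i))
        (ω.castDeg (by omega))) := by
    rw [eq_neg_iff_add_eq_zero]
    change _ + _ + _ = _
    rw [add_right_comm]
    exact add_eq_zero_iff_eq_neg.2 (hf.structure_eq k j h x).symm
  refine (congrArg (FormField.lieDeriv V) defect_eq).trans ?_
  rw [FormField.lieDeriv_neg, FormField.lieDeriv_smul,
    FormField.lieDeriv_contractMulti_castDeg_eq_zero (l := m + 1) _ hω hωV (fun i => hVv (x i)),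
    smul_zero, neg_zero]
  rfl

end IsCoMomentumMap

theorem mainTheorem2_general {𝔤 : Type*} [LieRing 𝔤] [LieAlgebra ℝ 𝔤]
    {ω : FormField E M (m + 2)} {H : FormField E M m} {v : 𝔤 →ₗ[ℝ] SmoothVectorField E M}
    {f : MomentumComponents E M 𝔤 (m + 1)} (hω : IsClosedForm ω) (hH : H.IsSmooth)
    (hωv : IsMultisymplecticAction ω v) (hHv : IsLocallyPreserving H v)
    (hf : IsCoMomentumMap ω v f) {V : SmoothVectorField E M}
    (hV : IsHamiltonianVectorField ω H V) {k j : ℕ} (h : k + 1 + j = m + 1)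
    {p : ⋀[ℝ]^(k + 1) 𝔤} (hp : p ∈ lieCycles 𝔤 k) :
    IsLocallyConserved V (f (k + 1) j h p : FormField E M j) := by
  have bracket_contract (x : 𝔤) : ω.contract (mlieBracket 𝓘(ℝ, E) V (v x)) = 0 :=
    hV.contract_mlieBracket_eq_zero hω.1 hH (hωv x) (hHv x).2
  have lieDeriv_d_momentum : (f (k + 1) j h p).1.d.lieDeriv V = 0 := by
    have h_defect := hf.lieDeriv_d_add_lieBoundary_eq_zero hω.1
      (hV.lieDeriv_eq_zero hω hH) bracket_contract h p
    rwa [LinearMap.mem_ker.1 hp, _root_.map_zero, ZeroMemClass.coe_zero, add_zero] at h_defect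
  have smooth := (f (k + 1) j h p).2
  exact ⟨FormField.IsSmooth.lieDeriv V smooth,
    (FormField.d_lieDeriv V smooth).trans lieDeriv_d_momentum⟩

end Conservation

theorem lieBoundary_eq_zero_of_isLieAbelian (𝔞 : Type*) [LieRing 𝔞] [LieAlgebra ℝ 𝔞]
    [IsLieAbelian 𝔞] (k : ℕ) : lieBoundary 𝔞 k = 0 := by
  cases k with
  | zero => rfl
  | succ k =>
    refine LinearMap.ext_on_range (exteriorPower.ιMulti_span ℝ (k + 2) 𝔞) fun x => ?_
    refine (exteriorPower.alternatingMapLinearEquiv_apply_ιMulti _ _).trans ?_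
    change lieBoundaryFun 𝔞 k x = 0
    refine Finset.sum_eq_zero fun i _ => Finset.sum_eq_zero fun j _ => ?_
    rw [trivial_lie_zero]
    exact (congrArg _ ((exteriorPower.ιMulti ℝ (k + 1)).map_coord_zero 0 rfl)).trans (smul_zero _)

section VectorSpace

variable {E : Type*} [NormedAddCommGroup E] [NormedSpace ℝ E] {k : ℕ}

theorem chartSymmDeriv_vectorSpace (x₀ y : E) :
    chartSymmDeriv x₀ y = ContinuousLinearMap.id ℝ E := by
  rw [chartSymmDeriv, extChartAt_model_space_eq_id]
  exact mfderiv_id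

theorem fieldInChart_vectorSpace (x₀ : E) (V : ∀ x : E, TangentSpace 𝓘(ℝ, E) x) :
    fieldInChart x₀ V = V := by
  funext y
  change (chartSymmDeriv x₀ y).inverse (V ((extChartAt 𝓘(ℝ, E) x₀).symm y)) = V y
  rw [chartSymmDeriv_vectorSpace, ContinuousLinearMap.inverse_id, extChartAt_model_space_eq_id]
  rfl

namespace FormField

theorem inChart_vectorSpace (x₀ : E) (α : FormField E E k) : inChart x₀ α = α := by
  funext y
  refine ContinuousAlternatingMap.ext fun w => ?_
  rw [inChart_apply, chartSymmDeriv_vectorSpace, extChartAt_model_space_eq_id]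
  rfl

theorem isSmooth_of_contDiff {α : E → E [⋀^Fin k]→L[ℝ] ℝ}
    (hα : ContDiff ℝ ((⊤ : ℕ∞) : WithTop ℕ∞) α) : IsSmooth (E := E) (M := E) α := fun x₀ =>
  hα.contDiffOn.congr fun y _ => congrFun (inChart_vectorSpace x₀ α) y

theorem d_vectorSpace (α : FormField E E k) : α.d = extDeriv (E := E) α := by
  funext z
  refine (d_apply α z).trans ?_
  rw [inChart_vectorSpace, extChartAt_model_space_eq_id]
  rfl

theorem lieDeriv_vectorSpace (V : ∀ x : E, TangentSpace 𝓘(ℝ, E) x) (α : FormField E E k) :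
    α.lieDeriv V = lieDerivModel V α := by
  funext z
  refine (lieDeriv_apply V α z).trans ?_
  rw [inChart_vectorSpace, fieldInChart_vectorSpace, extChartAt_model_space_eq_id]
  rfl

end FormField

variable (E) in
/-- Constant vector fields on a vector space. -/
def SmoothVectorField.const : E →ₗ[ℝ] SmoothVectorField E E where
  toFun w := ⟨fun _ => w, contMDiff_vectorSpace_iff_contDiff.2 contDiff_const⟩
  map_add' _ _ := rfl
  map_smul' _ _ := rfl

theorem mlieBracket_const (u w : E) :
    mlieBracket 𝓘(ℝ, E) (SmoothVectorField.const E u) (SmoothVectorField.const E w) = 0 := by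
  funext z
  rw [mlieBracket_eq_lieBracket_fieldInChart, fieldInChart_vectorSpace, fieldInChart_vectorSpace]
  change fderiv ℝ (fun _ => w) _ u - fderiv ℝ (fun _ => u) _ w = 0
  rw [fderiv_fun_const, fderiv_fun_const]
  exact sub_zero _

namespace SmoothForm

variable (E k) in
/-- Forms on a vector space with linear coefficients. -/
def linear : (E →L[ℝ] E [⋀^Fin k]→L[ℝ] ℝ) →ₗ[ℝ] SmoothForm E E k where
  toFun A := ⟨fun z => A z, FormField.isSmooth_of_contDiff A.contDiff⟩
  map_add' _ _ := rfl
  map_smul' _ _ := rfl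

/-- Forms on a vector space with constant coefficients. -/
def const (a : E [⋀^Fin k]→L[ℝ] ℝ) : SmoothForm E E k :=
  ⟨fun _ => a, FormField.isSmooth_of_contDiff contDiff_const⟩

theorem d_linear (A : E →L[ℝ] E [⋀^Fin k]→L[ℝ] ℝ) :
    (linear E k A).1.d = (const (alternatizeUncurryFin A)).1 := by
  refine (FormField.d_vectorSpace A).trans (funext fun z => ?_)
  rw [extDeriv, A.fderiv]
  rfl

theorem d_const (a : E [⋀^Fin k]→L[ℝ] ℝ) : (const a).1.d = 0 := by
  refine (FormField.d_vectorSpace fun _ => a).trans (funext fun z => ?_)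
  rw [extDeriv, fderiv_fun_const]
  exact map_zero (alternatizeUncurryFinCLM ℝ E ℝ)

theorem isClosedForm_const (a : E [⋀^Fin k]→L[ℝ] ℝ) : IsClosedForm (const a).1 :=
  ⟨(const a).2, d_const a⟩

theorem lieDeriv_linear (w : E) (A : E →L[ℝ] E [⋀^Fin k]→L[ℝ] ℝ) :
    (linear E k A).1.lieDeriv (SmoothVectorField.const E w) = (const (A w)).1 := by
  refine (FormField.lieDeriv_vectorSpace (fun _ => w) A).trans (funext fun z => ?_)
  rw [FormField.lieDerivModel, A.fderiv, fderiv_fun_const, Pi.zero_apply, _root_.map_zero, add_zero]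
  rfl

theorem lieDeriv_const (w : E) (a : E [⋀^Fin k]→L[ℝ] ℝ) :
    (const a).1.lieDeriv (SmoothVectorField.const E w) = 0 := by
  refine (FormField.lieDeriv_vectorSpace (fun _ => w) fun _ => a).trans (funext fun z => ?_)
  rw [FormField.lieDerivModel, fderiv_fun_const, fderiv_fun_const, Pi.zero_apply, Pi.zero_apply,
    _root_.map_zero, add_zero]
  rfl

theorem isHamiltonianVectorField_const_linear {a : E [⋀^Fin (k + 2)]→L[ℝ] ℝ}
    {A : E →L[ℝ] E [⋀^Fin k]→L[ℝ] ℝ} {w : E} (h : alternatizeUncurryFin A = -a.curryLeft w) :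
    IsHamiltonianVectorField (const a).1 (linear E k A).1 (SmoothVectorField.const E w) :=
  (d_linear A).trans (funext fun _ => h)

end SmoothForm

end VectorSpace

namespace TranslationExample

attribute [local instance] LieRing.ofAssociativeRing

instance isLieAbelian_plane : IsLieAbelian (Fin 2 → ℝ) :=
  isMulCommutative_iff_isLieAbelian.1 inferInstance

/-- The volume form `dx ∧ dy ∧ dz` at a point of `ℝ³`. -/
def volumeForm : R3 [⋀^Fin 3]→L[ℝ] ℝ :=
  { Matrix.detRowAlternating.compLinearMap (WithLp.linearEquiv 2 ℝ (Fin 3 → ℝ)).toLinearMap with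
    cont := by
      change Continuous fun u : Fin 3 → R3 => Matrix.det (Matrix.of fun r s => u r s)
      fun_prop }

theorem volumeForm_apply (u : Fin 3 → R3) :
    volumeForm u = Matrix.det (Matrix.of fun r s => u r s) :=
  rfl

/-- The function `zᵢ`, as the linear coefficient map of a zero-form. -/
def coordFun (i : Fin 3) : R3 →L[ℝ] R3 [⋀^Fin 0]→L[ℝ] ℝ :=
  (EuclideanSpace.proj i : R3 →L[ℝ] ℝ).smulRight (constOfIsEmpty ℝ R3 (Fin 0) 1)

/-- The one-form `zᵢ dzⱼ`, as the linear coefficient map. -/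
def coordOneForm (i j : Fin 3) : R3 →L[ℝ] R3 [⋀^Fin 1]→L[ℝ] ℝ :=
  (EuclideanSpace.proj i : R3 →L[ℝ] ℝ).smulRight
    (ofSubsingleton ℝ R3 ℝ (0 : Fin 1) (EuclideanSpace.proj j))

theorem coordFun_apply (i : Fin 3) (z : R3) (u : Fin 0 → R3) : coordFun i z u = z i :=
  mul_one (z i)

theorem coordOneForm_apply (i j : Fin 3) (z : R3) (u : Fin 1 → R3) :
    coordOneForm i j z u = z i * u 0 j :=
  rfl

/-- The linear map `ℝ² → ℝ³` taking the basis vectors to the directions of `∂_x`, `∂_y`. -/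
def direction : (Fin 2 → ℝ) →ₗ[ℝ] R3 :=
  (LinearMap.proj 0).smulRight (EuclideanSpace.single 0 1) +
    (LinearMap.proj 1).smulRight (EuclideanSpace.single 1 1)

theorem direction_apply (x : Fin 2 → ℝ) (i : Fin 3) : direction x i = ![x 0, x 1, 0] i := by
  fin_cases i <;> simp [direction]

theorem direction_basisFun_zero :
    direction (Pi.basisFun ℝ (Fin 2) 0) = EuclideanSpace.single 0 1 := by
  simp [direction]

theorem direction_basisFun_one :
    direction (Pi.basisFun ℝ (Fin 2) 1) = EuclideanSpace.single 1 1 := by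
  simp [direction]

/-- The action of the abelian Lie algebra `ℝ²` by translations along `∂_x` and `∂_y`. -/
def action : (Fin 2 → ℝ) →ₗ[ℝ] SmoothVectorField R3 R3 :=
  SmoothVectorField.const R3 ∘ₗ direction

/-- The Hamiltonian form `H = -x dy`. -/
def hamiltonianForm : SmoothForm R3 R3 1 := SmoothForm.linear R3 1 (-coordOneForm 0 1)

/-- The vector field `∂_z`, which is Hamiltonian for `-x dy`. -/
def hamiltonianField : SmoothVectorField R3 R3 :=
  SmoothVectorField.const R3 (EuclideanSpace.single 2 1)

/-- The coefficients of the first component of the co-momentum map, `a ↦ -y dz`, `b ↦ x dz`. -/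
def momentumOne : (Fin 2 → ℝ) →ₗ[ℝ] R3 →L[ℝ] R3 [⋀^Fin 1]→L[ℝ] ℝ :=
  (LinearMap.proj 0).smulRight (-coordOneForm 1 2) +
    (LinearMap.proj 1).smulRight (coordOneForm 0 2)

/-- The co-momentum map; the second component is `x ∧ y ↦ -det(x, y) z`. -/
def momentum : MomentumComponents R3 R3 (Fin 2 → ℝ) 2
  | 1, 1, _ => SmoothForm.linear R3 1 ∘ₗ momentumOne ∘ₗ
      (exteriorPower.oneEquiv ℝ (Fin 2 → ℝ)).toLinearMap
  | 2, 0, _ => SmoothForm.linear R3 0 ∘ₗ LinearMap.toSpanSingleton ℝ _ (-coordFun 2) ∘ₗ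
      exteriorPower.alternatingMapLinearEquiv Matrix.detRowAlternating
  | _, _, _ => 0

theorem momentumOne_apply (x : Fin 2 → ℝ) (z : R3) (u : Fin 1 → R3) :
    momentumOne x z u = x 0 * (-(z 1) * u 0 2) + x 1 * (z 0 * u 0 2) := by
  simp [momentumOne, coordOneForm_apply]

theorem momentum_one_ιMulti (x : Fin 1 → Fin 2 → ℝ) :
    momentum 1 1 rfl (exteriorPower.ιMulti ℝ 1 x) = SmoothForm.linear R3 1 (momentumOne (x 0)) := by
  rw [← exteriorPower.oneEquiv_ιMulti (R := ℝ) x]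
  rfl

theorem momentum_two_ιMulti (x : Fin 2 → Fin 2 → ℝ) :
    momentum 2 0 rfl (exteriorPower.ιMulti ℝ 2 x) =
      SmoothForm.linear R3 0 (Matrix.det (Matrix.of x) • -coordFun 2) :=
  congrArg (fun c : ℝ => SmoothForm.linear R3 0 (c • -coordFun 2))
    (exteriorPower.alternatingMapLinearEquiv_apply_ιMulti (R := ℝ) Matrix.detRowAlternating x)

theorem momentum_two_basisFun :
    momentum 2 0 rfl (exteriorPower.ιMulti ℝ 2
      ![Pi.basisFun ℝ (Fin 2) 0, Pi.basisFun ℝ (Fin 2) 1]) =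
      SmoothForm.linear R3 0 (-coordFun 2) := by
  simp [momentum_two_ιMulti, Matrix.det_fin_two]

theorem alternatizeUncurryFin_momentumOne (x : Fin 2 → ℝ) :
    alternatizeUncurryFin (momentumOne x) = -volumeForm.curryLeft (direction x) := by
  ext u
  simp only [ContinuousAlternatingMap.neg_apply, curryLeft_apply_apply]
  rw [volumeForm_apply, Matrix.det_fin_three, alternatizeUncurryFin_apply, Fin.sum_univ_two]
  simp [momentumOne_apply, direction_apply, Fin.removeNth, Fin.tail]
  ring

theorem alternatizeUncurryFin_det_smul_coordFun (x : Fin 2 → Fin 2 → ℝ) :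
    alternatizeUncurryFin (Matrix.det (Matrix.of x) • -coordFun 2) =
      -(volumeForm.curryLeft (direction (x 0))).curryLeft (direction (x 1)) := by
  ext u
  simp only [ContinuousAlternatingMap.neg_apply, curryLeft_apply_apply]
  rw [alternatizeUncurryFin_apply, volumeForm_apply, Matrix.det_fin_three, Matrix.det_fin_two]
  simp [direction_apply, coordFun_apply]
  ring

theorem curryLeft_direction_volumeForm_eq_zero (x : Fin 3 → Fin 2 → ℝ) :
    ((volumeForm.curryLeft (direction (x 0))).curryLeft (direction (x 1))).curryLeft
      (direction (x 2)) = 0 := by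
  ext u
  rw [curryLeft_apply_apply, curryLeft_apply_apply, curryLeft_apply_apply, volumeForm_apply,
    Matrix.det_fin_three]
  simp [direction_apply]

theorem alternatizeUncurryFin_coordOneForm :
    alternatizeUncurryFin (-coordOneForm 0 1) =
      -volumeForm.curryLeft (EuclideanSpace.single 2 1) := by
  ext u
  simp only [ContinuousAlternatingMap.neg_apply, curryLeft_apply_apply]
  rw [volumeForm_apply, Matrix.det_fin_three, alternatizeUncurryFin_apply, Fin.sum_univ_two]
  simp [coordOneForm_apply, Fin.removeNth, Fin.tail]
  ring

theorem isHamiltonianVectorField_hamiltonianField :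
    IsHamiltonianVectorField (m := 1) (SmoothForm.const volumeForm).1 hamiltonianForm.1
      hamiltonianField :=
  SmoothForm.isHamiltonianVectorField_const_linear alternatizeUncurryFin_coordOneForm

theorem isHamiltonianVectorField_action (x : Fin 2 → ℝ) :
    IsHamiltonianVectorField (m := 1) (SmoothForm.const volumeForm).1
      (SmoothForm.linear R3 1 (momentumOne x)).1 (action x) :=
  SmoothForm.isHamiltonianVectorField_const_linear (alternatizeUncurryFin_momentumOne x)

theorem isInfinitesimalAction_action : IsInfinitesimalAction action := fun x y => by
  rw [trivial_lie_zero, _root_.map_zero]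
  exact (mlieBracket_const (direction x) (direction y)).symm

theorem isGloballyPreserving_action : IsGloballyPreserving hamiltonianForm.1 action := fun x => by
  refine ⟨SmoothForm.linear R3 0 (x 0 • -coordFun 1), (SmoothForm.d_linear _).trans
    (Eq.trans ?_ (SmoothForm.lieDeriv_linear (direction x) _).symm)⟩
  congr 2
  ext u
  rw [alternatizeUncurryFin_apply]
  simp [coordFun_apply, coordOneForm_apply, direction_apply]

theorem d_momentum_one_add (x : Fin 2 → ℝ) :
    (SmoothForm.linear R3 1 (momentumOne x)).1.d +
      multiSign 1 • FormField.contract (action x) (SmoothForm.const volumeForm).1 = 0 := by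
  have multiSign_one : multiSign 1 = 1 := by norm_num [multiSign]
  rw [isHamiltonianVectorField_action x, multiSign_one, one_smul, neg_add_cancel]

theorem d_momentum_two_add (x : Fin 2 → Fin 2 → ℝ) :
    (SmoothForm.linear R3 0 (Matrix.det (Matrix.of x) • -coordFun 2)).1.d +
      multiSign 2 • FormField.contract (action (x 1))
        (FormField.contract (action (x 0)) (SmoothForm.const volumeForm).1) = 0 := by
  have multiSign_two : multiSign 2 = 1 := by norm_num [multiSign]
  rw [SmoothForm.d_linear, alternatizeUncurryFin_det_smul_coordFun, multiSign_two, one_smul]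
  exact funext fun _ => neg_add_cancel _

theorem isCoMomentumMap_momentum :
    IsCoMomentumMap (m := 1) (SmoothForm.const volumeForm).1 action momentum where
  zero_component := rfl
  hamiltonian x :=
    ⟨action (exteriorPower.oneEquiv ℝ _ x), isHamiltonianVectorField_action _⟩
  momentum x := by
    rw [momentum_one_ιMulti]
    exact isHamiltonianVectorField_action x
  structure_eq k j h x := by
    rw [lieBoundary_eq_zero_of_isLieAbelian, LinearMap.zero_apply, _root_.map_zero]
    refine neg_zero.trans (Eq.symm ?_)
    obtain ⟨rfl, rfl⟩ | ⟨rfl, rfl⟩ : k = 0 ∧ j = 1 ∨ k = 1 ∧ j = 0 := by omega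
    · rw [momentum_one_ιMulti]
      exact d_momentum_one_add (x 0)
    · rw [momentum_two_ιMulti]
      exact d_momentum_two_add x
  structure_eq_top x := by
    rw [lieBoundary_eq_zero_of_isLieAbelian, LinearMap.zero_apply, _root_.map_zero]
    refine neg_zero.trans (Eq.symm ?_)
    refine (congrArg (multiSign 3 • ·) (funext fun _ => ?_)).trans (smul_zero _)
    exact curryLeft_direction_volumeForm_eq_zero x

theorem ιMulti_basisFun_mem_lieCycles :
    exteriorPower.ιMulti ℝ 2 ![Pi.basisFun ℝ (Fin 2) 0, Pi.basisFun ℝ (Fin 2) 1] ∈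
      lieCycles (Fin 2 → ℝ) 1 :=
  LinearMap.congr_fun (lieBoundary_eq_zero_of_isLieAbelian _ 1) _

theorem lieDeriv_momentum_two_basisFun (z : R3) (u : Fin 0 → R3) :
    FormField.lieDeriv hamiltonianField (momentum 2 0 rfl (exteriorPower.ιMulti ℝ 2
      ![Pi.basisFun ℝ (Fin 2) 0, Pi.basisFun ℝ (Fin 2) 1])).1 z u = -1 := by
  rw [momentum_two_basisFun, hamiltonianField, SmoothForm.lieDeriv_linear]
  change -coordFun 2 (EuclideanSpace.single 2 1) u = -1
  rw [coordFun_apply, PiLp.single_apply, if_pos rfl]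

theorem not_isGloballyConserved_momentum_two_basisFun :
    ¬ IsGloballyConserved hamiltonianField (momentum 2 0 rfl (exteriorPower.ιMulti ℝ 2
      ![Pi.basisFun ℝ (Fin 2) 0, Pi.basisFun ℝ (Fin 2) 1])).1 := by
  intro lieDeriv_eq_zero
  have := (congrArg (fun α : FormField R3 R3 0 => α 0 ![]) lieDeriv_eq_zero).symm.trans
    (lieDeriv_momentum_two_basisFun 0 ![])
  exact neg_ne_zero.2 one_ne_zero this.symm

end TranslationExample

end

open TranslationExample in
theorem mainTheorem2 :
    -- the conservation law, for `n = m + 1` and degrees `1 ≤ k + 1 ≤ n`, `j = n - (k + 1)`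
    (∀ (E : Type*) [NormedAddCommGroup E] [NormedSpace ℝ E] [FiniteDimensional ℝ E]
      (M : Type*) [TopologicalSpace M] [ChartedSpace E M]
      [IsManifold 𝓘(ℝ, E) ((⊤ : ℕ∞) : WithTop ℕ∞) M]
      (𝔤 : Type*) [LieRing 𝔤] [LieAlgebra ℝ 𝔤] (m : ℕ)
      (ω : SmoothForm E M (m + 2)) (H : SmoothForm E M m)
      (v : 𝔤 →ₗ[ℝ] SmoothVectorField E M) (f : MomentumComponents E M 𝔤 (m + 1)),
      IsClosedForm (ω : FormField E M (m + 2)) →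
      IsInfinitesimalAction v →
      IsMultisymplecticAction (ω : FormField E M (m + 2)) v →
      IsLocallyPreserving (H : FormField E M m) v →
      IsCoMomentumMap (ω : FormField E M (m + 2)) v f →
      ∀ vH : SmoothVectorField E M,
        IsHamiltonianVectorField (ω : FormField E M (m + 2)) (H : FormField E M m) vH →
        ∀ (k j : ℕ) (h : k + 1 + j = m + 1), ∀ p ∈ lieCycles 𝔤 k,
          IsLocallyConserved vH (f (k + 1) j h p : FormField E M j)) ∧
    -- the example: `M = ℝ³`, `ω = dx ∧ dy ∧ dz`, `H = -x dy`, `v_H = ∂_z`, and the abelian Lie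
    -- algebra with basis `a = e 0`, `b = e 1` acting by `v_a = ∂_x`, `v_b = ∂_y`
    (∃ (𝔞 : Type) (_ : LieRing 𝔞) (_ : LieAlgebra ℝ 𝔞) (_ : IsLieAbelian 𝔞)
      (e : Module.Basis (Fin 2) ℝ 𝔞)
      (ω : SmoothForm R3 R3 3) (H : SmoothForm R3 R3 1) (vH : SmoothVectorField R3 R3)
      (v : 𝔞 →ₗ[ℝ] SmoothVectorField R3 R3) (f : MomentumComponents R3 R3 𝔞 2),
      (∀ (z : R3) (u : Fin 3 → R3), ω.1 z u = Matrix.det (Matrix.of fun r s => u r s)) ∧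
      (∀ (z : R3) (u : Fin 1 → R3), H.1 z u = -(z 0) * u 0 1) ∧
      (∀ z : R3, vH z = EuclideanSpace.single (2 : Fin 3) (1 : ℝ)) ∧
      (∀ z : R3, v (e 0) z = EuclideanSpace.single (0 : Fin 3) (1 : ℝ)) ∧
      (∀ z : R3, v (e 1) z = EuclideanSpace.single (1 : Fin 3) (1 : ℝ)) ∧
      IsClosedForm ω.1 ∧
      IsHamiltonianVectorField (m := 1) ω.1 H.1 vH ∧
      IsInfinitesimalAction v ∧
      IsMultisymplecticAction (m := 1) ω.1 v ∧
      IsLocallyPreserving H.1 v ∧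
      IsGloballyPreserving H.1 v ∧
      IsCoMomentumMap (m := 1) ω.1 v f ∧
      -- `f₁(a) = -y dz`, `f₁(b) = x dz`, `f₂(a ∧ b) = -z`
      (∀ (z : R3) (u : Fin 1 → R3),
        (f 1 1 rfl (exteriorPower.ιMulti ℝ 1 ![e 0])).1 z u = -(z 1) * u 0 2) ∧
      (∀ (z : R3) (u : Fin 1 → R3),
        (f 1 1 rfl (exteriorPower.ιMulti ℝ 1 ![e 1])).1 z u = z 0 * u 0 2) ∧
      (∀ (z : R3) (u : Fin 0 → R3),
        (f 2 0 rfl (exteriorPower.ιMulti ℝ 2 ![e 0, e 1])).1 z u = -(z 2)) ∧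
      -- `a ∧ b` is a cycle, `L_{v_H} f₂(a ∧ b) = -1`, and `f₂(a ∧ b)` is not globally conserved
      exteriorPower.ιMulti ℝ 2 ![e 0, e 1] ∈ lieCycles 𝔞 1 ∧
      (∀ (z : R3) (u : Fin 0 → R3),
        FormField.lieDeriv vH (f 2 0 rfl (exteriorPower.ιMulti ℝ 2 ![e 0, e 1])).1 z u = -1) ∧
      ¬ IsGloballyConserved vH (f 2 0 rfl (exteriorPower.ιMulti ℝ 2 ![e 0, e 1])).1) := by
  constructor
  · intro E _ _ _ M _ _ _ 𝔤 _ _ m ω H v f hω _ hωv hHv hf vH hvH k j h p hp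
    exact mainTheorem2_general hω H.2 hωv hHv hf hvH h hp
  refine ⟨Fin 2 → ℝ, LieRing.ofAssociativeRing, LieAlgebra.ofAssociativeAlgebra, isLieAbelian_plane,
    Pi.basisFun ℝ (Fin 2), SmoothForm.const volumeForm, hamiltonianForm, hamiltonianField, action,
    momentum, fun _ => volumeForm_apply, fun z u => (neg_mul (z 0) (u 0 1)).symm, fun _ => rfl,
    fun _ => direction_basisFun_zero, fun _ => direction_basisFun_one,
    SmoothForm.isClosedForm_const volumeForm, isHamiltonianVectorField_hamiltonianField,
    isInfinitesimalAction_action, fun x => SmoothForm.lieDeriv_const (direction x) volumeForm,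
    fun x => (isGloballyPreserving_action x).isClosedForm, isGloballyPreserving_action,
    isCoMomentumMap_momentum, ?_, ?_, ?_, ιMulti_basisFun_mem_lieCycles,
    lieDeriv_momentum_two_basisFun, not_isGloballyConserved_momentum_two_basisFun⟩
  · intro z u
    rw [momentum_one_ιMulti]
    exact (momentumOne_apply _ z u).trans (by simp)
  · intro z u
    rw [momentum_one_ιMulti]
    exact (momentumOne_apply _ z u).trans (by simp)
  · intro z u
    rw [momentum_two_basisFun]
    exact congrArg Neg.neg (coordFun_apply 2 z u)
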